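/- **Conventions.** For $M\in\mathbb R_{>0}^{\mathbb N}$ put $m_p:=M_p/p!$, $\mu_0:=1$ and $\mu_p:=M_p/M_{p-1}$ for $p\ge 1$ (similarly $n,\nu$ for $N$; $d,\delta$ for $D$; $l,\lambda$ for $L$). $M$ is log-convex (log-concave) if $M_p^2\le M_{p-1}M_{p+1}$ (resp. $\ge$) for all $p\ge1$. $\mathcal{LC}$ is the set of log-convex $M\in\mathbb R_{>0}^{\mathbb N}$ with $1=M_0\le M_1$ and $\lim_{p\to\infty}(M_p)^{1/p}=+\infty$. For a positive sequence $\mathbf a$ let, in $[-\infty,+\infty]$, $$\alpha(\mathbf a)=\inf\{\alpha\in\mathbb R:\exists H\ge1\ \forall\,1\le p\le q:\ a_q q^{-\alpha}\le H a_p p^{-\alpha}\},\qquad \beta(\mathbf a)=\sup\{\beta\in\mathbb R:\exists H\ge1\ \forall\,1\le p\le q:\ a_p p^{-\beta}\le H a_q q^{-\beta}\}.$$ Let $\omega_M(t)=\sup_{p\in\mathbb N}\log(t^p/M_p)$ for $t>0$, $\omega_M(0)=0$; $\omega_M$ satisfies $(\omega_1)$ if $\omega_M(2t)=O(\omega_M(t))$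 as $t\to+\infty$. For $N\in\mathcal{LC}$ let $\Sigma_N(t)=|\{p\ge1:\nu_p\le t\}|$. The dual sequence $D$ of $N$ is $D_p=\prod_{i=0}^p\delta_i$, where $\delta_{p+1}=\Sigma_N(p)$ for integers $p\ge\nu_1$ and $\delta_{p+1}=1$ for integers $-1\le p<\nu_1$. If $H\ge1$ is such that $\delta_q/q\le H\delta_p/p$ for all $1\le p\le q$, let $L=L^{(H)}$ be $L_p=\prod_{i=0}^p\lambda_i$ with $\lambda_0=1$ and $\lambda_p=H^{-1}p\,\sup_{q\ge p}\delta_q/q$ for $p\ge1$. A family $\mathfrak F$ of positive sequences is called *admissible* if (i) every $N\in\mathfrak F$ lies in $\mathcal{LC}$ and $1=N_0=N_1$; (ii) for every $N\in\mathfrak F$ there is $M\in\mathfrak F$ with $\omega_M(2t)=O(\omega_N(t))$ as $t\to+\infty$; (iii) there is $\mathbf a\in\mathbb R_{>0}^{\mathbb N}$ with $\lim_j a_j^{1/j}=0$ such that for every $N\in\mathfrak F$ there is $C>0$ with $n_j\le Ca_j$ for all $j\in\mathbb N$; (iv) $n$ is log-concave for every $N\in\mathfrak F$. **Theorem.** Let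 $N\in\mathcal{LC}$ satisfy $1<\beta(\nu)\le\alpha(\nu)<+\infty$ and let $D$ be its dual sequence. Then $D\in\mathcal{LC}$, $D_0=D_1=1$, $\beta(\delta)>0$ and $\omega_D$ satisfies $(\omega_1)$. Some $H\ge 1$ with $\delta_q/q\le H\delta_p/p$ for all $1\le p\le q$ exists, and for every such $H$ the sequence $L=L^{(H)}$ has the following properties. 1. $L$ satisfies all requirements of $\mathcal{LC}$ except possibly $L_0\le L_1$: it is positive and log-convex, $L_0=1$ and $\lim_p(L_p)^{1/p}=+\infty$; moreover $L_1\le1$. 2. $\lim_{p\to\infty}(l_p)^{1/p}=0$, $\omega_L$ satisfies $(\omega_1)$, and $l$ is log-concave. 3. There is a least $p_0\ge1$ such that $\lambda_p\ge1$ for all $p>p_0$. Let $\widetilde L_p=\prod_{i=0}^p\widetilde\lambda_i$ with $\widetilde\lambda_p=1$ for $p\le p_0$ and $\widetilde\lambda_p=\lambda_p$ for $p>p_0$. Then the family $\{\widetilde L\}$ is admissible. -/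

import Mathlib

open Filter Topology

noncomputable section

/-! Weight sequences are positive real sequences `M : ℕ → ℝ`. -/

/-- The quotients `μ_0 = 1`, `μ_p = M_p / M_{p-1}` for `p ≥ 1`. -/
def quotientSeq (M : ℕ → ℝ) : ℕ → ℝ
  | 0 => 1
  | p + 1 => M (p + 1) / M p

/-- The sequence `p ↦ ∏_{i=0}^p μ_i` built from quotients `μ`. -/
def seqOfQuotients (μ : ℕ → ℝ) (p : ℕ) : ℝ :=
  ∏ i ∈ Finset.range (p + 1), μ i

/-- The sequence `m_p = M_p / p!`. -/
def divFactorial (M : ℕ → ℝ) (p : ℕ) : ℝ :=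
  M p / (p.factorial : ℝ)

/-- The sequence of roots `(M_p)^{1/p}` (only its tail matters). -/
def rootSeq (M : ℕ → ℝ) (p : ℕ) : ℝ :=
  (M p) ^ (1 / (p : ℝ))

/-- `M_p ^ 2 ≤ M_{p-1} M_{p+1}` for all `p ≥ 1`. -/
def LogConvexSeq (M : ℕ → ℝ) : Prop :=
  ∀ p : ℕ, M (p + 1) ^ 2 ≤ M p * M (p + 2)

/-- `M_p ^ 2 ≥ M_{p-1} M_{p+1}` for all `p ≥ 1`. -/
def LogConcaveSeq (M : ℕ → ℝ) : Prop :=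
  ∀ p : ℕ, M p * M (p + 2) ≤ M (p + 1) ^ 2

/-- All requirements of the class `𝓛𝓒` except `M_0 ≤ M_1`. -/
structure IsPreLC (M : ℕ → ℝ) : Prop where
  pos : ∀ p, 0 < M p
  zero : M 0 = 1
  logConvex : LogConvexSeq M
  root_tendsto : Tendsto (rootSeq M) atTop atTop

/-- The class `𝓛𝓒`: positive, normalized (`1 = M_0 ≤ M_1`), log-convex, and
`(M_p)^{1/p} → ∞`. -/
structure IsLC (M : ℕ → ℝ) : Prop extends IsPreLC M where
  zero_le_one : M 0 ≤ M 1

/-- `a_q ≤ H a_p` for all `1 ≤ p ≤ q`. -/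
def AlmostDecreasingWith (H : ℝ) (a : ℕ → ℝ) : Prop :=
  ∀ p q : ℕ, 1 ≤ p → p ≤ q → a q ≤ H * a p

/-- `a_p ≤ H a_q` for all `1 ≤ p ≤ q`. -/
def AlmostIncreasingWith (H : ℝ) (a : ℕ → ℝ) : Prop :=
  ∀ p q : ℕ, 1 ≤ p → p ≤ q → a p ≤ H * a q

/-- The upper Matuszewska index `α(a)`, with values in `[-∞, ∞]`. -/
def upperMatuszewska (a : ℕ → ℝ) : EReal :=
  sInf ((fun r : ℝ => (r : EReal)) ''
    {r : ℝ | ∃ H : ℝ, 1 ≤ H ∧ AlmostDecreasingWith H (fun p => a p / (p : ℝ) ^ r)})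

/-- The lower Matuszewska index `β(a)`, with values in `[-∞, ∞]`. -/
def lowerMatuszewska (a : ℕ → ℝ) : EReal :=
  sSup ((fun r : ℝ => (r : EReal)) ''
    {r : ℝ | ∃ H : ℝ, 1 ≤ H ∧ AlmostIncreasingWith H (fun p => a p / (p : ℝ) ^ r)})

/-- The counting function `Σ_M(t) = #{p ≥ 1 : μ_p ≤ t}`
(a finite set when `M ∈ 𝓛𝓒`, since then `μ_p → ∞`). -/
def countingFn (M : ℕ → ℝ) (t : ℝ) : ℕ :=
  Set.ncard {p : ℕ | 1 ≤ p ∧ quotientSeq M p ≤ t}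

/-- The quotients `δ` of the dual sequence of `N`: `δ_{p+1} = Σ_N(p)` for `p ≥ ν_1`, and
`δ_{p+1} = 1` for integers `-1 ≤ p < ν_1`. -/
def dualQuotients (N : ℕ → ℝ) : ℕ → ℝ
  | 0 => 1
  | p + 1 => if quotientSeq N 1 ≤ (p : ℝ) then (countingFn N (p : ℝ) : ℝ) else 1

/-- The dual sequence `D` of `N`. -/
def dualSeq (N : ℕ → ℝ) : ℕ → ℝ :=
  seqOfQuotients (dualQuotients N)

/-- `H ≥ 1` is a constant witnessing that `(μ_p / p)_{p ≥ 1}` is almost decreasing. -/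
def IsAlmostDecreasingConst (μ : ℕ → ℝ) (H : ℝ) : Prop :=
  1 ≤ H ∧ AlmostDecreasingWith H (fun p => μ p / (p : ℝ))

/-- The quotients `λ_0 = 1`, `λ_p = H⁻¹ p sup_{q ≥ p} μ_q / q` for `p ≥ 1`. The supremum is that
of a bounded set when `H` witnesses that `μ_p / p` is almost decreasing. -/
def regularizedQuotients (H : ℝ) (μ : ℕ → ℝ) : ℕ → ℝ
  | 0 => 1
  | p + 1 => H⁻¹ * ((p + 1 : ℕ) : ℝ) * ⨆ q : Set.Ici (p + 1), μ q / ((q : ℕ) : ℝ)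

/-- The sequence `L` with quotients `regularizedQuotients H μ`. -/
def regularizedSeq (H : ℝ) (μ : ℕ → ℝ) : ℕ → ℝ :=
  seqOfQuotients (regularizedQuotients H μ)

/-- The modification of finitely many quotients: `1` for indices `≤ p₀`, `λ_p` for `p > p₀`. -/
def modifiedSeq (p₀ : ℕ) (lam : ℕ → ℝ) : ℕ → ℝ :=
  seqOfQuotients (fun p => if p ≤ p₀ then 1 else lam p)

/-- The associated function `ω_M(t) = sup_p log (t^p / M_p)` for `t > 0`, `ω_M(0) = 0`,
with values in the extended reals. -/
def assocWeight (M : ℕ → ℝ) (t : ℝ) : EReal :=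
  if 0 < t then ⨆ p : ℕ, ((Real.log (t ^ p / M p) : ℝ) : EReal) else 0

/-- `ω_M(2t) = O(ω_N(t))` as `t → ∞` (both functions are non-negative when `M_0 = N_0 = 1`). -/
def MixedOmegaOne (M N : ℕ → ℝ) : Prop :=
  ∃ C : ℝ, 0 < C ∧ ∀ᶠ t : ℝ in atTop,
    assocWeight M (2 * t) ≤ (C : EReal) * assocWeight N t

/-- Condition `(ω_1)` for `ω_M`: `ω_M(2t) = O(ω_M(t))` as `t → ∞`. -/
def OmegaOne (M : ℕ → ℝ) : Prop := MixedOmegaOne M M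

/-- The requirements on a family `𝔉` of weight sequences in the boundedness criterion for normal
operators: membership in `𝓛𝓒` with `1 = N_0 = N_1`, the mixed `(ω_1)`-condition, a uniform bound
`a` with `a_j^{1/j} → 0`, and log-concavity of each `n = (N_j / j!)_j`. -/
structure IsAdmissibleFamily (F : Set (ℕ → ℝ)) : Prop where
  mem_LC : ∀ N ∈ F, IsLC N ∧ N 0 = 1 ∧ N 1 = 1
  mixed_omega_one : ∀ N ∈ F, ∃ M ∈ F, MixedOmegaOne M N
  uniform_bound : ∃ a : ℕ → ℝ, (∀ j, 0 < a j) ∧ Tendsto (rootSeq a) atTop (𝓝 0) ∧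
    ∀ N ∈ F, ∃ C : ℝ, 0 < C ∧ ∀ j, divFactorial N j ≤ C * a j
  logConcave : ∀ N ∈ F, LogConcaveSeq (divFactorial N)

end

/-! ### Sequences built from quotients -/

theorem seqOfQuotients_succ (μ : ℕ → ℝ) (p : ℕ) :
    seqOfQuotients μ (p + 1) = seqOfQuotients μ p * μ (p + 1) :=
  Finset.prod_range_succ _ _

theorem seqOfQuotients_zero (μ : ℕ → ℝ) : seqOfQuotients μ 0 = μ 0 := by
  simp [seqOfQuotients]

theorem seqOfQuotients_pos {μ : ℕ → ℝ} (hpos : ∀ p, 0 < μ p) (p : ℕ) :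
    0 < seqOfQuotients μ p :=
  Finset.prod_pos fun i _ => hpos i

theorem seqOfQuotients_eq_prod_succ {μ : ℕ → ℝ} (h0 : μ 0 = 1) (p : ℕ) :
    seqOfQuotients μ p = ∏ i ∈ Finset.range p, μ (i + 1) := by
  rw [seqOfQuotients, Finset.prod_range_succ', h0, mul_one]

theorem divFactorial_seqOfQuotients {μ : ℕ → ℝ} (h0 : μ 0 = 1) (p : ℕ) :
    divFactorial (seqOfQuotients μ) p = ∏ i ∈ Finset.range p, μ (i + 1) / ((i + 1 : ℕ) : ℝ) := by
  rw [divFactorial, seqOfQuotients_eq_prod_succ h0, Finset.prod_div_distrib,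
    ← Finset.prod_range_add_one_eq_factorial]
  push_cast
  rfl

/-- If positive factors tend to `0`, so do the geometric means. -/
theorem tendsto_root_prod_zero {u : ℕ → ℝ} (hpos : ∀ i, 0 < u i)
    (hu : Tendsto u atTop (𝓝 0)) :
    Tendsto (rootSeq fun p => ∏ i ∈ Finset.range p, u i) atTop (𝓝 0) := by
  have hc := hu.cesaro
  refine squeeze_zero' (Eventually.of_forall fun p => ?_) ?_ hc
  · exact Real.rpow_nonneg (Finset.prod_nonneg fun i _ => (hpos i).le) _
  · filter_upwards [eventually_ge_atTop 1] with p hp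
    have hp' : (p : ℝ) ≠ 0 := by positivity
    have h := Real.geom_mean_le_arith_mean_weighted (Finset.range p) (fun _ => 1 / (p : ℝ)) u
      (fun _ _ => by positivity) (by simp [hp']) (fun i _ => (hpos i).le)
    rw [Real.finsetProd_rpow _ _ (fun i _ => (hpos i).le), ← Finset.mul_sum] at h
    simpa [rootSeq] using h

/-- If positive factors tend to `∞`, so do the geometric means. -/
theorem tendsto_root_prod_atTop {u : ℕ → ℝ} (hpos : ∀ i, 0 < u i)
    (hu : Tendsto u atTop atTop) :
    Tendsto (rootSeq fun p => ∏ i ∈ Finset.range p, u i) atTop atTop := by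
  have h := tendsto_root_prod_zero (fun i => inv_pos.2 (hpos i)) hu.inv_tendsto_atTop
  have h' : Tendsto (rootSeq fun p => ∏ i ∈ Finset.range p, (u i)⁻¹) atTop (𝓝[>] 0) :=
    tendsto_nhdsWithin_iff.2 ⟨h, Eventually.of_forall fun p =>
      Real.rpow_pos_of_pos (Finset.prod_pos fun i _ => inv_pos.2 (hpos i)) _⟩
  refine h'.inv_tendsto_nhdsGT_zero.congr fun p => ?_
  simp only [Pi.inv_apply, rootSeq, Finset.prod_inv_distrib]
  rw [Real.inv_rpow (Finset.prod_nonneg fun i _ => (hpos i).le), inv_inv]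

theorem isPreLC_seqOfQuotients {μ : ℕ → ℝ} (h0 : μ 0 = 1) (hpos : ∀ p, 0 < μ p)
    (hmono : ∀ p, 1 ≤ p → μ p ≤ μ (p + 1)) (htop : Tendsto μ atTop atTop) :
    IsPreLC (seqOfQuotients μ) where
  pos := seqOfQuotients_pos hpos
  zero := by rw [seqOfQuotients_zero, h0]
  logConvex p := by
    have hS := seqOfQuotients_pos hpos p
    rw [seqOfQuotients_succ _ (p + 1), seqOfQuotients_succ]
    have h1 := mul_le_mul_of_nonneg_left (hmono (p + 1) (by omega))
      (mul_nonneg (sq_nonneg (seqOfQuotients μ p)) (hpos (p + 1)).le)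
    linarith
  root_tendsto := by
    have h := tendsto_root_prod_atTop (fun i => hpos (i + 1))
      ((tendsto_add_atTop_iff_nat 1).2 htop)
    rwa [← funext (seqOfQuotients_eq_prod_succ h0)] at h

theorem tendsto_root_divFactorial_zero {μ : ℕ → ℝ} (h0 : μ 0 = 1) (hpos : ∀ p, 0 < μ p)
    (hlim : Tendsto (fun p : ℕ => μ p / (p : ℝ)) atTop (𝓝 0)) :
    Tendsto (rootSeq (divFactorial (seqOfQuotients μ))) atTop (𝓝 0) := by
  have h := tendsto_root_prod_zero (u := fun i => μ (i + 1) / ((i + 1 : ℕ) : ℝ))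
    (fun i => div_pos (hpos _) (by positivity))
    ((tendsto_add_atTop_iff_nat (f := fun p : ℕ => μ p / (p : ℝ)) 1).2 hlim)
  rwa [← funext (divFactorial_seqOfQuotients h0)] at h

theorem logConcaveSeq_divFactorial {μ : ℕ → ℝ} (h0 : μ 0 = 1) (hpos : ∀ p, 0 < μ p)
    (hanti : ∀ p : ℕ, 1 ≤ p → μ (p + 1) / ((p + 1 : ℕ) : ℝ) ≤ μ p / (p : ℝ)) :
    LogConcaveSeq (divFactorial (seqOfQuotients μ)) := by
  intro p
  simp only [divFactorial_seqOfQuotients h0]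
  rw [Finset.prod_range_succ _ (p + 1), Finset.prod_range_succ]
  have hq : 0 ≤ μ (p + 1) / ((p + 1 : ℕ) : ℝ) := div_nonneg (hpos _).le (by positivity)
  have h1 := mul_le_mul_of_nonneg_left (hanti (p + 1) (by omega))
    (mul_nonneg (sq_nonneg (∏ i ∈ Finset.range p, μ (i + 1) / ((i + 1 : ℕ) : ℝ))) hq)
  linarith

/-! ### The condition `(ω₁)` -/

/-- The sums `∑_{i=1}^n log⁺ (t / μ_i)`. -/
noncomputable def posLogSum (μ : ℕ → ℝ) (t : ℝ) (n : ℕ) : ℝ :=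
  ∑ i ∈ Finset.range n, max 0 (Real.log (t / μ (i + 1)))

theorem posLogSum_succ (μ : ℕ → ℝ) (t : ℝ) (n : ℕ) :
    posLogSum μ t (n + 1) = posLogSum μ t n + max 0 (Real.log (t / μ (n + 1))) :=
  Finset.sum_range_succ _ _

theorem posLogSum_mono (μ : ℕ → ℝ) (t : ℝ) : Monotone (posLogSum μ t) :=
  monotone_nat_of_le_succ fun n => by
    rw [posLogSum_succ]
    exact le_add_of_nonneg_right (le_max_left _ _)

theorem log_pow_div_seqOfQuotients {μ : ℕ → ℝ} (h0 : μ 0 = 1) (hpos : ∀ p, 0 < μ p)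
    {t : ℝ} (ht : 0 < t) (n : ℕ) :
    Real.log (t ^ n / seqOfQuotients μ n) =
      ∑ i ∈ Finset.range n, Real.log (t / μ (i + 1)) := by
  rw [← Real.log_prod (fun i _ => (div_pos ht (hpos _)).ne'), Finset.prod_div_distrib,
    seqOfQuotients_eq_prod_succ h0]
  simp

theorem exists_posLogSum_eq {μ : ℕ → ℝ} (h0 : μ 0 = 1) (hpos : ∀ p, 0 < μ p)
    (hmono : ∀ p q, 1 ≤ p → p ≤ q → μ p ≤ μ q) {t : ℝ} (ht : 0 < t) (n : ℕ) :
    ∃ k, posLogSum μ t n = Real.log (t ^ k / seqOfQuotients μ k) := by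
  induction n with
  | zero => exact ⟨0, by simp [posLogSum, seqOfQuotients_zero, h0]⟩
  | succ n ih =>
    by_cases h : μ (n + 1) ≤ t
    · refine ⟨n + 1, ?_⟩
      rw [log_pow_div_seqOfQuotients h0 hpos ht]
      refine Finset.sum_congr rfl fun i hi => max_eq_right (Real.log_nonneg ?_)
      rw [one_le_div (hpos _)]
      exact (hmono _ _ (by omega) (by simp at hi; omega)).trans h
    · obtain ⟨k, hk⟩ := ih
      refine ⟨k, ?_⟩
      rw [posLogSum_succ, hk, max_eq_left, add_zero]
      exact Real.log_nonpos (div_pos ht (hpos _)).le ((div_le_one (hpos _)).2 (not_le.1 h).le)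

theorem posLogSum_le_assocWeight {μ : ℕ → ℝ} (h0 : μ 0 = 1) (hpos : ∀ p, 0 < μ p)
    (hmono : ∀ p q, 1 ≤ p → p ≤ q → μ p ≤ μ q) {t : ℝ} (ht : 0 < t) (n : ℕ) :
    ((posLogSum μ t n : ℝ) : EReal) ≤ assocWeight (seqOfQuotients μ) t := by
  obtain ⟨k, hk⟩ := exists_posLogSum_eq h0 hpos hmono ht n
  rw [assocWeight, if_pos ht, hk]
  exact le_iSup (fun p : ℕ => ((Real.log (t ^ p / seqOfQuotients μ p) : ℝ) : EReal)) k

theorem posLogSum_add_le {μ : ℕ → ℝ} {t : ℝ} {m : ℕ} {x : ℝ}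
    (hx : ∀ i, m < i → max 0 (Real.log (t / μ i)) ≤ x) (j : ℕ) :
    posLogSum μ t (m + j) ≤ posLogSum μ t m + j * x := by
  induction j with
  | zero => simp
  | succ j ih =>
    rw [← add_assoc, posLogSum_succ]
    push_cast
    linarith [hx (m + j + 1) (by omega)]

theorem posLogSum_two_mul_le {μ : ℕ → ℝ} (hpos : ∀ p, 0 < μ p)
    (hmono : ∀ p q, 1 ≤ p → p ≤ q → μ p ≤ μ q) {Q : ℕ}
    (hQ : ∀ p, 1 ≤ p → 2 * μ p ≤ μ ((Q + 1) * p)) {t : ℝ} (ht : 0 < t) (n : ℕ) :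
    posLogSum μ (2 * t) ((Q + 1) * n + Q) ≤
      Q * max 0 (Real.log (2 * t / μ 1)) + (Q + 1) * posLogSum μ t n := by
  have key : ∀ (a b s r : ℝ), 0 < a → 0 < b → 0 < s → s / a ≤ r / b →
      max 0 (Real.log (s / a)) ≤ max 0 (Real.log (r / b)) := fun a b s r ha hb hs h =>
    max_le_max le_rfl (Real.log_le_log (div_pos hs ha) h)
  induction n with
  | zero =>
    have h := posLogSum_add_le (μ := μ) (t := 2 * t) (m := 0)
      (x := max 0 (Real.log (2 * t / μ 1))) (fun i hi => key _ _ _ _ (hpos _) (hpos _)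
        (by positivity) (by gcongr; exacts [hpos _, hmono _ _ le_rfl hi])) Q
    simpa [posLogSum] using h
  | succ n ih =>
    have h := posLogSum_add_le (μ := μ) (t := 2 * t) (m := (Q + 1) * n + Q)
      (x := max 0 (Real.log (t / μ (n + 1)))) (fun i hi => key _ _ _ _ (hpos _) (hpos _)
        (by positivity) (by
          rw [div_le_div_iff₀ (hpos _) (hpos _)]
          have h1 := (hQ (n + 1) (by omega)).trans
            (hmono _ i (Nat.mul_pos (by omega) (by omega)) (by linarith))
          nlinarith)) (Q + 1)
    rw [posLogSum_succ, show (Q + 1) * (n + 1) + Q = (Q + 1) * n + Q + (Q + 1) by ring]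
    push_cast at h
    linarith

theorem omegaOne_of_two_mul_le {μ : ℕ → ℝ} (h0 : μ 0 = 1) (hpos : ∀ p, 0 < μ p)
    (hmono : ∀ p q, 1 ≤ p → p ≤ q → μ p ≤ μ q) {Q : ℕ}
    (hQ : ∀ p, 1 ≤ p → 2 * μ p ≤ μ ((Q + 1) * p)) : OmegaOne (seqOfQuotients μ) := by
  refine ⟨3 * Q + 1, by positivity, ?_⟩
  filter_upwards [eventually_ge_atTop (2 * μ 1)] with t ht
  have h1 := hpos 1
  have htpos : 0 < t := by linarith
  have hC : (0 : EReal) ≤ ((3 * Q + 1 : ℝ) : EReal) := by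
    exact_mod_cast (by positivity : (0 : ℝ) ≤ 3 * Q + 1)
  conv_lhs => rw [assocWeight, if_pos (by positivity : 0 < 2 * t)]
  refine iSup_le fun n => ?_
  refine le_trans ?_ (mul_le_mul_of_nonneg_left
    (posLogSum_le_assocWeight h0 hpos hmono htpos (n + 1)) hC)
  rw [← EReal.coe_mul, EReal.coe_le_coe_iff, log_pow_div_seqOfQuotients h0 hpos (by positivity)]
  have hx : 1 ≤ t / μ 1 := by rw [one_le_div h1]; linarith
  have hlog : Real.log (2 * t / μ 1) ≤ 2 * Real.log (t / μ 1) := by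
    rw [← Real.log_rpow (by positivity)]
    apply Real.log_le_log (by positivity)
    rw [Real.rpow_two, div_pow, div_le_div_iff₀ h1 (by positivity)]
    nlinarith [mul_pos htpos h1]
  have hmax : max 0 (Real.log (2 * t / μ 1)) ≤ 2 * posLogSum μ t (n + 1) := by
    have hle : posLogSum μ t 1 ≤ posLogSum μ t (n + 1) := posLogSum_mono μ t (by omega)
    have he : posLogSum μ t 1 = Real.log (t / μ 1) := by
      simp [posLogSum, Real.log_nonneg hx]
    have := Real.log_nonneg hx
    exact max_le (by linarith) (by linarith)
  have hB := posLogSum_two_mul_le hpos hmono hQ htpos (n + 1)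
  have hA : posLogSum μ (2 * t) n ≤ posLogSum μ (2 * t) ((Q + 1) * (n + 1) + Q) :=
    posLogSum_mono _ _ (by nlinarith)
  have h2 : ∑ i ∈ Finset.range n, Real.log (2 * t / μ (i + 1)) ≤ posLogSum μ (2 * t) n :=
    Finset.sum_le_sum fun i _ => le_max_right _ _
  have h3 := mul_le_mul_of_nonneg_left hmax (Nat.cast_nonneg (α := ℝ) Q)
  nlinarith

/-! ### Quotients of a sequence in `𝓛𝓒` and of its dual -/

theorem quotientSeq_pos {N : ℕ → ℝ} (hN : IsPreLC N) (p : ℕ) : 0 < quotientSeq N p := by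
  cases p with
  | zero => exact one_pos
  | succ p => exact div_pos (hN.pos _) (hN.pos _)

theorem quotientSeq_mono {N : ℕ → ℝ} (hN : IsPreLC N) {p q : ℕ} (hp : 1 ≤ p) (hpq : p ≤ q) :
    quotientSeq N p ≤ quotientSeq N q := by
  induction q, hpq using Nat.le_induction with
  | base => exact le_rfl
  | succ q hq ih =>
    refine ih.trans ?_
    obtain ⟨r, rfl⟩ : ∃ r, q = r + 1 := ⟨q - 1, by omega⟩
    change N (r + 1) / N r ≤ N (r + 2) / N (r + 1)
    rw [div_le_div_iff₀ (hN.pos _) (hN.pos _)]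
    linarith [hN.logConvex r]

theorem one_le_quotientSeq {N : ℕ → ℝ} (hN : IsLC N) {p : ℕ} (hp : 1 ≤ p) :
    1 ≤ quotientSeq N p := by
  refine le_trans ?_ (quotientSeq_mono hN.toIsPreLC le_rfl hp)
  change 1 ≤ N 1 / N 0
  rw [one_le_div (hN.pos _)]
  exact hN.zero_le_one

theorem exists_lt_quotientSeq {N : ℕ → ℝ} (hN : IsPreLC N) (C : ℝ) :
    ∃ p, 1 ≤ p ∧ C < quotientSeq N p := by
  by_contra! h
  have hC : 0 < C := (quotientSeq_pos hN 1).trans_le (h 1 le_rfl)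
  have hle : ∀ p, N p ≤ C ^ p := by
    intro p
    induction p with
    | zero => simp [hN.zero]
    | succ p ih =>
      have h1 : N (p + 1) / N p ≤ C := h (p + 1) (by omega)
      rw [div_le_iff₀ (hN.pos p)] at h1
      rw [pow_succ']
      exact h1.trans (mul_le_mul_of_nonneg_left ih hC.le)
  obtain ⟨p, hp1, hp2⟩ := ((eventually_ge_atTop 1).and
    (hN.root_tendsto.eventually (eventually_gt_atTop C))).exists
  have h2 : rootSeq N p ≤ (C ^ p) ^ (1 / (p : ℝ)) :=
    Real.rpow_le_rpow (hN.pos p).le (hle p) (by positivity)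
  rw [one_div, Real.pow_rpow_inv_natCast hC.le (by omega)] at h2
  exact absurd hp2 (not_lt.2 h2)

theorem le_countingFn_iff {N : ℕ → ℝ} (hN : IsPreLC N) {k : ℕ} (hk : 1 ≤ k) (t : ℝ) :
    k ≤ countingFn N t ↔ quotientSeq N k ≤ t := by
  have hsub : ∀ j, 1 ≤ j → t < quotientSeq N j →
      {p : ℕ | 1 ≤ p ∧ quotientSeq N p ≤ t} ⊆ ↑(Finset.Ico 1 j) := by
    intro j hj1 hj p hp
    simp only [Finset.coe_Ico, Set.mem_Ico]
    refine ⟨hp.1, ?_⟩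
    by_contra! hjp
    exact absurd (hj.trans_le (quotientSeq_mono hN hj1 hjp)) (not_lt.2 hp.2)
  constructor
  · intro h
    by_contra! hlt
    have h1 := Set.ncard_le_ncard (hsub k hk hlt) (Finset.finite_toSet _)
    rw [Set.ncard_coe_finset, Nat.card_Ico] at h1
    unfold countingFn at h
    omega
  · intro h
    obtain ⟨j, hj1, hj⟩ := exists_lt_quotientSeq hN t
    have hfin := (Finset.finite_toSet _).subset (hsub j hj1 hj)
    have h1 : (↑(Finset.Icc 1 k) : Set ℕ) ⊆ {p : ℕ | 1 ≤ p ∧ quotientSeq N p ≤ t} := by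
      intro p hp
      simp only [Finset.coe_Icc, Set.mem_Icc] at hp
      exact ⟨hp.1, (quotientSeq_mono hN hp.1 hp.2).trans h⟩
    have h2 := Set.ncard_le_ncard h1 hfin
    rw [Set.ncard_coe_finset, Nat.card_Icc] at h2
    unfold countingFn
    omega

theorem one_le_dualQuotients {N : ℕ → ℝ} (hN : IsPreLC N) (p : ℕ) : 1 ≤ dualQuotients N p := by
  cases p with
  | zero => exact le_rfl
  | succ p =>
    simp only [dualQuotients]
    split_ifs with h
    · exact_mod_cast (le_countingFn_iff hN le_rfl _).2 h
    · exact le_rfl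

theorem dualQuotients_one {N : ℕ → ℝ} (hN : IsPreLC N) : dualQuotients N 1 = 1 := by
  have h := quotientSeq_pos hN 1
  simp only [dualQuotients, Nat.cast_zero]
  rw [if_neg (not_le.2 h)]

theorem dualQuotients_mono {N : ℕ → ℝ} (hN : IsPreLC N) : Monotone (dualQuotients N) := by
  refine monotone_nat_of_le_succ fun p => ?_
  cases p with
  | zero => exact one_le_dualQuotients hN 1
  | succ p =>
    by_cases h : quotientSeq N 1 ≤ (p : ℝ)
    · have h' : quotientSeq N 1 ≤ ((p + 1 : ℕ) : ℝ) := by push_cast; linarith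
      simp only [dualQuotients]
      rw [if_pos h, if_pos h', Nat.cast_le]
      have h1 := (le_countingFn_iff hN le_rfl _).2 h
      exact (le_countingFn_iff hN h1 _).2
        (((le_countingFn_iff hN h1 _).1 le_rfl).trans (by push_cast; linarith))
    · have h1 : dualQuotients N (p + 1) = 1 := by simp only [dualQuotients]; rw [if_neg h]
      rw [h1]
      exact one_le_dualQuotients hN _

theorem tendsto_dualQuotients {N : ℕ → ℝ} (hN : IsPreLC N) :
    Tendsto (dualQuotients N) atTop atTop := by
  refine tendsto_atTop_atTop_of_monotone (dualQuotients_mono hN) fun K => ?_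
  set k := max 1 ⌈K⌉₊
  have hk : 1 ≤ k := le_max_left _ _
  set s := ⌈quotientSeq N k⌉₊
  have hs : quotientSeq N k ≤ s := Nat.le_ceil _
  refine ⟨s + 1, ?_⟩
  simp only [dualQuotients]
  rw [if_pos ((quotientSeq_mono hN le_rfl hk).trans hs)]
  calc K ≤ ⌈K⌉₊ := Nat.le_ceil _
    _ ≤ (k : ℝ) := by exact_mod_cast le_max_right _ _
    _ ≤ _ := by exact_mod_cast (le_countingFn_iff hN hk _).2 hs

/-- The quotients `δ` of the dual sequence invert `ν` up to constants. -/
theorem exists_dualQuotients_eq {N : ℕ → ℝ} (hN : IsLC N) {p : ℕ} (hp : 1 ≤ p) :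
    ∃ k : ℕ, 1 ≤ k ∧ dualQuotients N p = k ∧ quotientSeq N k ≤ quotientSeq N 1 * p ∧
      (p : ℝ) ≤ 2 * quotientSeq N (k + 1) := by
  obtain ⟨s, rfl⟩ : ∃ s, p = s + 1 := ⟨p - 1, by omega⟩
  have h1 := one_le_quotientSeq hN le_rfl
  have hs : (0 : ℝ) ≤ s := Nat.cast_nonneg s
  by_cases h : quotientSeq N 1 ≤ (s : ℝ)
  · have hk := (le_countingFn_iff hN.toIsPreLC le_rfl _).2 h
    refine ⟨countingFn N s, hk, by simp only [dualQuotients]; rw [if_pos h], ?_, ?_⟩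
    · have h2 := (le_countingFn_iff hN.toIsPreLC hk _).1 le_rfl
      push_cast
      nlinarith
    · have h2 := (le_countingFn_iff hN.toIsPreLC (k := countingFn N s + 1) (by omega) s).not.1
        (by omega)
      have h3 := one_le_quotientSeq hN (p := countingFn N s + 1) (by omega)
      push_cast
      linarith
  · refine ⟨1, le_rfl, by simp only [dualQuotients]; rw [if_neg h, Nat.cast_one], ?_, ?_⟩
    · push_cast
      nlinarith
    · have h2 := quotientSeq_mono hN.toIsPreLC (p := 1) (q := 1 + 1) le_rfl (by omega)
      push_cast
      linarith

/-! ### Matuszewska indices of the dual quotients -/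

theorem exists_almostIncreasing_dualQuotients {N : ℕ → ℝ} (hN : IsLC N)
    (hα : upperMatuszewska (quotientSeq N) < ⊤) :
    ∃ c : ℝ, 0 < c ∧ ∃ C : ℝ, 1 ≤ C ∧
      AlmostIncreasingWith C (fun p => dualQuotients N p / (p : ℝ) ^ c) := by
  obtain ⟨_, ⟨a₀, ⟨H, hH, hdec⟩, rfl⟩, -⟩ := sInf_lt_iff.1 hα
  obtain ⟨a, ha0, ha1⟩ : ∃ a : ℝ, 0 < a ∧ a₀ ≤ a :=
    ⟨max a₀ 1, lt_max_of_lt_right one_pos, le_max_left _ _⟩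
  have h1 := one_le_quotientSeq hN le_rfl
  have h2a : 1 ≤ (2 : ℝ) ^ a := Real.one_le_rpow (by norm_num) ha0.le
  have hC : 1 ≤ 2 * H * quotientSeq N 1 * 2 ^ a :=
    one_le_mul_of_one_le_of_one_le
      (one_le_mul_of_one_le_of_one_le (by linarith) h1) h2a
  set C := 2 * H * quotientSeq N 1 * 2 ^ a
  refine ⟨a⁻¹, inv_pos.2 ha0, C ^ a⁻¹, Real.one_le_rpow hC (inv_pos.2 ha0).le, ?_⟩
  intro p q hp hpq
  have hp0 : (0 : ℝ) < p := by exact_mod_cast hp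
  have hq0 : (0 : ℝ) < q := by exact_mod_cast hp.trans hpq
  obtain ⟨k, hk, hkδ, hk1, -⟩ := exists_dualQuotients_eq hN hp
  obtain ⟨m, hm, hmδ, -, hm2⟩ := exists_dualQuotients_eq hN (hp.trans hpq)
  have hkm : k ≤ m := by
    have := dualQuotients_mono hN.toIsPreLC hpq
    rw [hkδ, hmδ] at this
    exact_mod_cast this
  have hk0 : (0 : ℝ) < k := by exact_mod_cast hk
  have hm1 : (1 : ℝ) ≤ m := by exact_mod_cast hm
  have hkm' : (k : ℝ) ≤ m := by exact_mod_cast hkm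
  have hd := hdec k (m + 1) hk (by omega)
  simp only at hd
  have hν : quotientSeq N (m + 1) ≤ H * quotientSeq N k * ((2 * m : ℝ) / k) ^ a := by
    have hm0 : (0 : ℝ) < (m + 1 : ℕ) := by positivity
    have hpow : ((m + 1 : ℕ) / k : ℝ) ^ a₀ ≤ ((2 * m : ℝ) / k) ^ a := by
      refine (Real.rpow_le_rpow_of_exponent_le ?_ ha1).trans
        (Real.rpow_le_rpow (by positivity) ?_ ha0.le)
      · rw [one_le_div hk0]; push_cast; linarith
      · gcongr; push_cast; linarith
    rw [div_le_iff₀ (Real.rpow_pos_of_pos hm0 _)] at hd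
    refine hd.trans ?_
    rw [show H * (quotientSeq N k / (k : ℝ) ^ a₀) * ((m + 1 : ℕ) : ℝ) ^ a₀ =
      H * quotientSeq N k * (((m + 1 : ℕ) : ℝ) / k) ^ a₀ by
        rw [Real.div_rpow hm0.le hk0.le]; ring]
    have := quotientSeq_pos hN.toIsPreLC k
    gcongr
  have hq : (q : ℝ) ≤ C * p * ((m : ℝ) / k) ^ a := by
    have hx : ((2 * m : ℝ) / k) ^ a = 2 ^ a * ((m : ℝ) / k) ^ a := by
      rw [mul_div_assoc, Real.mul_rpow (by norm_num) (by positivity)]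
    calc (q : ℝ) ≤ 2 * quotientSeq N (m + 1) := hm2
      _ ≤ 2 * (H * (quotientSeq N 1 * p) * ((2 * m : ℝ) / k) ^ a) := by
        refine mul_le_mul_of_nonneg_left (hν.trans ?_) (by norm_num)
        gcongr
      _ = _ := by rw [hx]; simp only [C]; ring
  have hr := Real.rpow_le_rpow hq0.le hq (inv_pos.2 ha0).le
  rw [Real.mul_rpow (by positivity) (by positivity), Real.mul_rpow (by positivity) hp0.le,
    ← Real.rpow_mul (by positivity), mul_inv_cancel₀ ha0.ne', Real.rpow_one] at hr
  simp only [hkδ, hmδ]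
  rw [← mul_div_assoc, div_le_div_iff₀ (Real.rpow_pos_of_pos hp0 _) (Real.rpow_pos_of_pos hq0 _)]
  calc (k : ℝ) * (q : ℝ) ^ a⁻¹ ≤ k * (C ^ a⁻¹ * (p : ℝ) ^ a⁻¹ * (m / k)) := by gcongr
    _ = _ := by field_simp

theorem exists_almostDecreasing_dualQuotients {N : ℕ → ℝ} (hN : IsLC N)
    (hβ : 1 < lowerMatuszewska (quotientSeq N)) :
    ∃ e : ℝ, e < 1 ∧ ∃ C : ℝ, 1 ≤ C ∧
      AlmostDecreasingWith C (fun p => dualQuotients N p / (p : ℝ) ^ e) := by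
  obtain ⟨_, ⟨b, ⟨H, hH, hinc⟩, rfl⟩, hb⟩ := lt_sSup_iff.1 hβ
  have hb1 : 1 < b := EReal.coe_lt_coe_iff.1 hb
  have hb0 : 0 < b := by linarith
  have h1 := one_le_quotientSeq hN le_rfl
  have hC : 1 ≤ 2 * H * quotientSeq N 1 :=
    one_le_mul_of_one_le_of_one_le (by linarith) h1
  set C := 2 * H * quotientSeq N 1
  refine ⟨b⁻¹, inv_lt_one_of_one_lt₀ hb1, 2 * C ^ b⁻¹, ?_, ?_⟩
  · linarith [Real.one_le_rpow hC (inv_pos.2 hb0).le]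
  intro p q hp hpq
  have hp0 : (0 : ℝ) < p := by exact_mod_cast hp
  have hq0 : (0 : ℝ) < q := by exact_mod_cast hp.trans hpq
  have hpq' : (p : ℝ) ≤ q := by exact_mod_cast hpq
  obtain ⟨k, hk, hkδ, -, hk2⟩ := exists_dualQuotients_eq hN hp
  obtain ⟨m, hm, hmδ, hm1, -⟩ := exists_dualQuotients_eq hN (hp.trans hpq)
  have hk0 : (0 : ℝ) < k := by exact_mod_cast hk
  have hk1 : (1 : ℝ) ≤ k := by exact_mod_cast hk
  have hm0 : (0 : ℝ) < m := by exact_mod_cast hm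
  have hmain : (p : ℝ) * ((m : ℝ) / (2 * k)) ^ b ≤ C * q := by
    by_cases hkm : k + 1 ≤ m
    · have hd := hinc (k + 1) m (by omega) hkm
      simp only at hd
      have hk10 : (0 : ℝ) < (k + 1 : ℕ) := by positivity
      rw [← mul_div_assoc, div_le_div_iff₀ (Real.rpow_pos_of_pos hk10 _)
        (Real.rpow_pos_of_pos hm0 _)] at hd
      have hpow : ((m : ℝ) / (2 * k)) ^ b ≤ ((m : ℝ) / (k + 1 : ℕ)) ^ b := by
        refine Real.rpow_le_rpow (by positivity) ?_ hb0.le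
        gcongr
        push_cast
        linarith
      have hν : quotientSeq N (k + 1) * ((m : ℝ) / (k + 1 : ℕ)) ^ b ≤ H * quotientSeq N m := by
        rw [Real.div_rpow hm0.le hk10.le, ← mul_div_assoc,
          div_le_iff₀ (Real.rpow_pos_of_pos hk10 _)]
        exact hd
      calc (p : ℝ) * ((m : ℝ) / (2 * k)) ^ b
          ≤ (2 * quotientSeq N (k + 1)) * ((m : ℝ) / (k + 1 : ℕ)) ^ b :=
            mul_le_mul hk2 hpow (by positivity) (hp0.le.trans hk2)
        _ ≤ 2 * (H * quotientSeq N m) := by linarith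
        _ ≤ 2 * (H * (quotientSeq N 1 * q)) := by gcongr
        _ = C * q := by simp only [C]; ring
    · have hmk : (m : ℝ) ≤ k := by exact_mod_cast (by omega : m ≤ k)
      have : ((m : ℝ) / (2 * k)) ^ b ≤ 1 := by
        refine Real.rpow_le_one (by positivity) ?_ hb0.le
        rw [div_le_one (by positivity)]
        linarith
      nlinarith
  have hr := Real.rpow_le_rpow (by positivity) hmain (inv_pos.2 hb0).le
  rw [Real.mul_rpow hp0.le (by positivity), Real.mul_rpow (by positivity) hq0.le,
    ← Real.rpow_mul (by positivity), mul_inv_cancel₀ hb0.ne', Real.rpow_one] at hr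
  simp only [hkδ, hmδ]
  rw [← mul_div_assoc, div_le_div_iff₀ (Real.rpow_pos_of_pos hq0 _) (Real.rpow_pos_of_pos hp0 _)]
  calc (m : ℝ) * (p : ℝ) ^ b⁻¹ = 2 * k * ((p : ℝ) ^ b⁻¹ * (m / (2 * k))) := by field_simp
    _ ≤ 2 * k * (C ^ b⁻¹ * (q : ℝ) ^ b⁻¹) := by gcongr
    _ = _ := by ring

theorem AlmostDecreasingWith.div_self {a : ℕ → ℝ} {e C : ℝ} (he : e < 1)
    (ha : ∀ p, 0 ≤ a p) (hC : 0 ≤ C)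
    (h : AlmostDecreasingWith C (fun p => a p / (p : ℝ) ^ e)) :
    AlmostDecreasingWith C (fun p => a p / (p : ℝ)) := by
  intro p q hp hpq
  have hp0 : (0 : ℝ) < p := by exact_mod_cast hp
  have hq0 : (0 : ℝ) < q := by exact_mod_cast hp.trans hpq
  have key : ∀ x : ℕ, (0 : ℝ) < x → a x / (x : ℝ) = a x / (x : ℝ) ^ e * (x : ℝ) ^ (e - 1) := by
    intro x hx
    rw [Real.rpow_sub_one hx.ne']
    have := Real.rpow_pos_of_pos hx e
    field_simp
  simp only
  rw [key p hp0, key q hq0, ← mul_assoc]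
  have h1 : (q : ℝ) ^ (e - 1) ≤ (p : ℝ) ^ (e - 1) :=
    Real.rpow_le_rpow_of_nonpos hp0 (by exact_mod_cast hpq) (by linarith)
  exact mul_le_mul (h p q hp hpq) h1 (by positivity)
    (mul_nonneg hC (div_nonneg (ha p) (by positivity)))

theorem AlmostDecreasingWith.tendsto_div_self {a : ℕ → ℝ} {e C : ℝ} (he : e < 1)
    (ha : ∀ p, 0 ≤ a p) (h : AlmostDecreasingWith C (fun p => a p / (p : ℝ) ^ e)) :
    Tendsto (fun p : ℕ => a p / (p : ℝ)) atTop (𝓝 0) := by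
  have hlim : Tendsto (fun p : ℕ => C * a 1 * (p : ℝ) ^ (-(1 - e))) atTop (𝓝 0) := by
    simpa using ((tendsto_rpow_neg_atTop (sub_pos.2 he)).comp
      tendsto_natCast_atTop_atTop).const_mul (C * a 1)
  refine squeeze_zero' (Eventually.of_forall fun p => div_nonneg (ha p) (Nat.cast_nonneg p)) ?_
    hlim
  filter_upwards [eventually_ge_atTop 1] with q hq
  have hq0 : (0 : ℝ) < q := by exact_mod_cast hq
  have h1 := h 1 q le_rfl hq
  simp only [Nat.cast_one, Real.one_rpow, div_one] at h1
  have h2 := Real.rpow_pos_of_pos hq0 e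
  rw [neg_sub, Real.rpow_sub_one hq0.ne', ← mul_div_assoc]
  rw [div_le_iff₀ h2] at h1
  gcongr

theorem AlmostIncreasingWith.exists_mul_le {a : ℕ → ℝ} {c C : ℝ} (hc : 0 < c)
    (ha : ∀ p, 0 ≤ a p) (hC : 1 ≤ C)
    (h : AlmostIncreasingWith C (fun p => a p / (p : ℝ) ^ c)) (K : ℝ) :
    ∃ Q : ℕ, ∀ p, 1 ≤ p → K * a p ≤ a ((Q + 1) * p) := by
  have hlim : Tendsto (fun Q : ℕ => ((Q + 1 : ℕ) : ℝ) ^ c) atTop atTop :=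
    (tendsto_rpow_atTop hc).comp
      (tendsto_natCast_atTop_atTop.comp (tendsto_add_atTop_nat 1))
  obtain ⟨Q, hQ⟩ := (hlim.eventually_ge_atTop (C * K)).exists
  refine ⟨Q, fun p hp => ?_⟩
  have hp0 : (0 : ℝ) < p := by exact_mod_cast hp
  have h1 := h p ((Q + 1) * p) hp (Nat.le_mul_of_pos_left p (by omega))
  simp only at h1
  have hpc := Real.rpow_pos_of_pos hp0 c
  have hQc : (0 : ℝ) < ((Q + 1 : ℕ) : ℝ) ^ c := Real.rpow_pos_of_pos (by positivity) c
  rw [Nat.cast_mul, Real.mul_rpow (by positivity) hp0.le, ← mul_div_assoc,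
    div_le_div_iff₀ hpc (mul_pos hQc hpc), ← mul_assoc] at h1
  have h2 := le_of_mul_le_mul_right h1 hpc
  have h3 : a p * (C * K) ≤ C * a ((Q + 1) * p) :=
    (mul_le_mul_of_nonneg_left hQ (ha p)).trans h2
  have hC0 : 0 < C := by linarith
  refine le_of_mul_le_mul_left ?_ hC0
  linarith

theorem omegaOne_of_comparable {δ μ : ℕ → ℝ} (h0 : μ 0 = 1) (hpos : ∀ p, 0 < μ p)
    (hmono : ∀ p q, 1 ≤ p → p ≤ q → μ p ≤ μ q) {K : ℝ} (hK : 0 < K)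
    (hle : ∀ p, 1 ≤ p → μ p ≤ δ p) (hge : ∀ p, 1 ≤ p → δ p ≤ K * μ p)
    (hδ : ∀ A : ℝ, ∃ Q : ℕ, ∀ p, 1 ≤ p → A * δ p ≤ δ ((Q + 1) * p)) :
    OmegaOne (seqOfQuotients μ) := by
  obtain ⟨Q, hQ⟩ := hδ (2 * K)
  refine omegaOne_of_two_mul_le h0 hpos hmono (Q := Q) fun p hp => ?_
  have h1 := (hQ p hp).trans (hge _ (Nat.mul_pos Q.succ_pos hp))
  have h2 := mul_le_mul_of_nonneg_left (hle p hp) hK.le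
  refine le_of_mul_le_mul_left ?_ hK
  linarith

/-! ### The regularized quotients -/

section Regularized

variable {H : ℝ} {δ : ℕ → ℝ}

theorem bddAbove_regularized (h : IsAlmostDecreasingConst δ H) {p : ℕ} (hp : 1 ≤ p) :
    BddAbove (Set.range fun q : Set.Ici p => δ q / ((q : ℕ) : ℝ)) := by
  refine ⟨H * (δ p / (p : ℝ)), ?_⟩
  rintro _ ⟨⟨q, hq⟩, rfl⟩
  exact h.2 p q hp hq

theorem regularizedQuotients_eq {p : ℕ} (hp : 1 ≤ p) :
    regularizedQuotients H δ p = H⁻¹ * p * ⨆ q : Set.Ici p, δ q / ((q : ℕ) : ℝ) := by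
  obtain ⟨s, rfl⟩ : ∃ s, p = s + 1 := ⟨p - 1, by omega⟩
  rfl

theorem regularizedQuotients_le (h : IsAlmostDecreasingConst δ H) {p : ℕ} (hp : 1 ≤ p) :
    regularizedQuotients H δ p ≤ δ p := by
  have hH : 0 < H := one_pos.trans_le h.1
  have hp0 : (0 : ℝ) < p := by exact_mod_cast hp
  have hs : (⨆ q : Set.Ici p, δ q / ((q : ℕ) : ℝ)) ≤ H * (δ p / (p : ℝ)) :=
    ciSup_le fun ⟨q, hq⟩ => h.2 p q hp hq
  rw [regularizedQuotients_eq hp]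
  calc H⁻¹ * p * (⨆ q : Set.Ici p, δ q / ((q : ℕ) : ℝ))
      ≤ H⁻¹ * p * (H * (δ p / (p : ℝ))) := by gcongr
    _ = δ p := by field_simp

theorem le_regularizedQuotients (h : IsAlmostDecreasingConst δ H) {p q : ℕ} (hp : 1 ≤ p)
    (hpq : p ≤ q) : δ q / (q : ℝ) ≤ H * (regularizedQuotients H δ p / p) := by
  have hH : 0 < H := one_pos.trans_le h.1
  have hp0 : (0 : ℝ) < p := by exact_mod_cast hp
  rw [regularizedQuotients_eq hp]
  have := le_ciSup (bddAbove_regularized h hp) ⟨q, hpq⟩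
  refine this.trans_eq ?_
  field_simp

theorem le_mul_regularizedQuotients (h : IsAlmostDecreasingConst δ H) {p : ℕ} (hp : 1 ≤ p) :
    δ p ≤ H * regularizedQuotients H δ p := by
  have hp0 : (0 : ℝ) < p := by exact_mod_cast hp
  have h1 := le_regularizedQuotients h hp le_rfl
  rwa [← mul_div_assoc, div_le_div_iff_of_pos_right hp0] at h1

theorem regularizedQuotients_div_le (h : IsAlmostDecreasingConst δ H) {p q : ℕ} (hp : 1 ≤ p)
    (hpq : p ≤ q) :
    regularizedQuotients H δ q / (q : ℝ) ≤ regularizedQuotients H δ p / (p : ℝ) := by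
  have hH : 0 < H := one_pos.trans_le h.1
  have hq0 : (0 : ℝ) < q := by exact_mod_cast hp.trans hpq
  have hs : (⨆ r : Set.Ici q, δ r / ((r : ℕ) : ℝ)) ≤ H * (regularizedQuotients H δ p / p) :=
    ciSup_le fun ⟨r, hr⟩ => le_regularizedQuotients h hp (hpq.trans hr)
  rw [regularizedQuotients_eq (hp.trans hpq)]
  calc H⁻¹ * q * (⨆ r : Set.Ici q, δ r / ((r : ℕ) : ℝ)) / (q : ℝ)
      = H⁻¹ * (⨆ r : Set.Ici q, δ r / ((r : ℕ) : ℝ)) := by field_simp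
    _ ≤ H⁻¹ * (H * (regularizedQuotients H δ p / p)) := by gcongr
    _ = _ := by field_simp

theorem regularizedQuotients_mono (h : IsAlmostDecreasingConst δ H) (hδ : Monotone δ)
    (hδ0 : ∀ p, 0 < δ p) {p q : ℕ} (hp : 1 ≤ p) (hpq : p ≤ q) :
    regularizedQuotients H δ p ≤ regularizedQuotients H δ q := by
  have hH : 0 < H := one_pos.trans_le h.1
  have hp0 : (0 : ℝ) < p := by exact_mod_cast hp
  have hq0 : (0 : ℝ) < q := by exact_mod_cast hp.trans hpq
  have hpq' : (p : ℝ) ≤ q := by exact_mod_cast hpq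
  suffices hs : (⨆ r : Set.Ici p, δ r / ((r : ℕ) : ℝ)) ≤ H * regularizedQuotients H δ q / p by
    rw [regularizedQuotients_eq hp]
    calc H⁻¹ * p * (⨆ r : Set.Ici p, δ r / ((r : ℕ) : ℝ))
        ≤ H⁻¹ * p * (H * regularizedQuotients H δ q / p) := by gcongr
      _ = _ := by field_simp
  refine ciSup_le fun ⟨r, hr⟩ => ?_
  have hpr : (p : ℝ) ≤ r := by exact_mod_cast hr
  have hr0 : (0 : ℝ) < r := hp0.trans_le hpr
  rw [div_le_div_iff₀ hr0 hp0]
  rcases le_total r q with hrq | hqr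
  · calc δ r * p ≤ δ q * r := mul_le_mul (hδ hrq) hpr hp0.le (hδ0 q).le
      _ ≤ _ := by gcongr; exact le_mul_regularizedQuotients h (hp.trans hpq)
  · have h1 := le_regularizedQuotients h (hp.trans hpq) hqr
    rw [← mul_div_assoc, div_le_div_iff₀ hr0 hq0] at h1
    exact (mul_le_mul_of_nonneg_left hpq' (hδ0 r).le).trans h1

theorem regularizedQuotients_pos (h : IsAlmostDecreasingConst δ H) (hδ0 : ∀ p, 0 < δ p) (p : ℕ) :
    0 < regularizedQuotients H δ p := by
  rcases Nat.eq_zero_or_pos p with rfl | hp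
  · exact one_pos
  · exact pos_of_mul_pos_right ((hδ0 p).trans_le (le_mul_regularizedQuotients h hp))
      (zero_le_one.trans h.1)

theorem tendsto_regularizedQuotients (h : IsAlmostDecreasingConst δ H)
    (hδ : Tendsto δ atTop atTop) : Tendsto (regularizedQuotients H δ) atTop atTop := by
  have hH : 0 < H := one_pos.trans_le h.1
  refine tendsto_atTop_mono' atTop ?_ (hδ.const_mul_atTop (inv_pos.2 hH))
  filter_upwards [eventually_ge_atTop 1] with p hp
  rw [inv_mul_le_iff₀ hH]
  exact le_mul_regularizedQuotients h hp

theorem tendsto_regularizedQuotients_div (h : IsAlmostDecreasingConst δ H) (hδ0 : ∀ p, 0 < δ p)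
    (hδ : Tendsto (fun p : ℕ => δ p / (p : ℝ)) atTop (𝓝 0)) :
    Tendsto (fun p : ℕ => regularizedQuotients H δ p / (p : ℝ)) atTop (𝓝 0) := by
  refine squeeze_zero' (Eventually.of_forall fun p =>
    div_nonneg (regularizedQuotients_pos h hδ0 p).le (Nat.cast_nonneg p)) ?_ hδ
  filter_upwards [eventually_ge_atTop 1] with p hp
  exact div_le_div_of_nonneg_right (regularizedQuotients_le h hp) (Nat.cast_nonneg p)

/-- The least index after which all regularized quotients are at least `1`. -/
theorem exists_isLeast_one_le_regularizedQuotients (h : IsAlmostDecreasingConst δ H)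
    (hδ : Tendsto δ atTop atTop) :
    ∃ p₀, IsLeast {k : ℕ | 1 ≤ k ∧ ∀ p, k < p → 1 ≤ regularizedQuotients H δ p} p₀ := by
  obtain ⟨k, hk⟩ := eventually_atTop.1
    ((tendsto_regularizedQuotients h hδ).eventually (eventually_ge_atTop 1))
  have hne : {k : ℕ | 1 ≤ k ∧ ∀ p, k < p → 1 ≤ regularizedQuotients H δ p}.Nonempty :=
    ⟨k + 1, by omega, fun p hp => hk p (by omega)⟩
  exact ⟨sInf _, Nat.sInf_mem hne, fun _ hm => Nat.sInf_le hm⟩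

theorem regularizedQuotients_le_one (h : IsAlmostDecreasingConst δ H) (hδ1 : δ 1 = 1) {p₀ : ℕ}
    (hp₀ : IsLeast {k : ℕ | 1 ≤ k ∧ ∀ p, k < p → 1 ≤ regularizedQuotients H δ p} p₀) :
    regularizedQuotients H δ p₀ ≤ 1 := by
  by_cases h1 : p₀ = 1
  · subst h1
    exact (regularizedQuotients_le h le_rfl).trans_eq hδ1
  · by_contra! hlt
    have h1' := hp₀.1.1
    have hmem : p₀ - 1 ∈ {k : ℕ | 1 ≤ k ∧ ∀ p, k < p → 1 ≤ regularizedQuotients H δ p} := by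
      refine ⟨by omega, fun p hp => ?_⟩
      rcases (by omega : p = p₀ ∨ p₀ < p) with rfl | hp'
      · exact hlt.le
      · exact hp₀.1.2 p hp'
    have := hp₀.2 hmem
    omega

theorem isAdmissibleFamily_modifiedSeq (h : IsAlmostDecreasingConst δ H) (hδm : Monotone δ)
    (hδ1 : δ 1 = 1) (hδge : ∀ p, 1 ≤ δ p) (hδ : Tendsto δ atTop atTop)
    (hδdiv : Tendsto (fun p : ℕ => δ p / (p : ℝ)) atTop (𝓝 0))
    (hδQ : ∀ A : ℝ, ∃ Q : ℕ, ∀ p, 1 ≤ p → A * δ p ≤ δ ((Q + 1) * p)) {p₀ : ℕ}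
    (hp₀ : IsLeast {k : ℕ | 1 ≤ k ∧ ∀ p, k < p → 1 ≤ regularizedQuotients H δ p} p₀) :
    IsAdmissibleFamily {modifiedSeq p₀ (regularizedQuotients H δ)} := by
  have hδ0 : ∀ p, 0 < δ p := fun p => one_pos.trans_le (hδge p)
  have hp1 : 1 ≤ p₀ := hp₀.1.1
  have hlam1 : ∀ p, p₀ < p → 1 ≤ regularizedQuotients H δ p := hp₀.1.2
  have hH : 0 < H := one_pos.trans_le h.1
  set μ : ℕ → ℝ := fun p => if p ≤ p₀ then 1 else regularizedQuotients H δ p with hμ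
  have hμle : ∀ p, p ≤ p₀ → μ p = 1 := fun p hp => if_pos hp
  have hμgt : ∀ p, p₀ < p → μ p = regularizedQuotients H δ p := fun p hp => if_neg (not_le.2 hp)
  have h0 : μ 0 = 1 := hμle 0 (Nat.zero_le _)
  have hge : ∀ p, 1 ≤ μ p := fun p => by
    rcases le_or_gt p p₀ with hp | hp
    · exact (hμle p hp).ge
    · exact (hlam1 p hp).trans_eq (hμgt p hp).symm
  have hpos : ∀ p, 0 < μ p := fun p => one_pos.trans_le (hge p)
  have hmono : ∀ p q, 1 ≤ p → p ≤ q → μ p ≤ μ q := fun p q hp hpq => by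
    rcases le_or_gt p p₀ with hp' | hp'
    · exact (hμle p hp').trans_le (hge q)
    · rw [hμgt p hp', hμgt q (hp'.trans_le hpq)]
      exact regularizedQuotients_mono h hδm hδ0 hp hpq
  have hevent : regularizedQuotients H δ =ᶠ[atTop] μ := by
    filter_upwards [eventually_gt_atTop p₀] with p hp using (hμgt p hp).symm
  have htop : Tendsto μ atTop atTop := (tendsto_regularizedQuotients h hδ).congr' hevent
  have hdiv : Tendsto (fun p : ℕ => μ p / (p : ℝ)) atTop (𝓝 0) :=
    (tendsto_regularizedQuotients_div h hδ0 hδdiv).congr'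
      (hevent.mono fun p hp => by simp only [hp])
  have hanti : ∀ p : ℕ, 1 ≤ p → μ (p + 1) / ((p + 1 : ℕ) : ℝ) ≤ μ p / (p : ℝ) := by
    intro p hp
    have hp0 : (0 : ℝ) < p := by exact_mod_cast hp
    rcases lt_or_ge p p₀ with hlt | hge
    · rw [hμle p hlt.le, hμle (p + 1) hlt]
      gcongr
      exact Nat.le_succ p
    · rw [hμgt (p + 1) (by omega)]
      refine (regularizedQuotients_div_le h hp (Nat.le_succ p)).trans ?_
      rcases hge.eq_or_lt with rfl | hgt
      · rw [hμle _ le_rfl]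
        exact div_le_div_of_nonneg_right (regularizedQuotients_le_one h hδ1 hp₀) hp0.le
      · rw [hμgt p hgt]
  have hpre : IsPreLC (seqOfQuotients μ) :=
    isPreLC_seqOfQuotients h0 hpos (fun p hp => hmono _ _ hp (Nat.le_succ p)) htop
  have hS1 : seqOfQuotients μ 1 = 1 := by
    rw [seqOfQuotients_succ, seqOfQuotients_zero, h0, hμle 1 hp1, one_mul]
  have homega : OmegaOne (seqOfQuotients μ) := by
    refine omegaOne_of_comparable h0 hpos hmono (K := H * δ p₀) (mul_pos hH (hδ0 _)) ?_ ?_ hδQ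
    · intro p hp
      rcases le_or_gt p p₀ with hp' | hp'
      · exact (hμle p hp').trans_le (hδge p)
      · exact (hμgt p hp').trans_le (regularizedQuotients_le h hp)
    · intro p hp
      rcases le_or_gt p p₀ with hp' | hp'
      · rw [hμle p hp', mul_one]
        exact (hδm hp').trans (le_mul_of_one_le_left (hδ0 _).le h.1)
      · rw [hμgt p hp']
        have hl := regularizedQuotients_pos h hδ0 p
        refine (le_mul_regularizedQuotients h hp).trans ?_
        exact mul_le_mul_of_nonneg_right (le_mul_of_one_le_right hH.le (hδge _)) hl.le
  exact
    { mem_LC := by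
        rintro _ rfl
        exact ⟨⟨hpre, (hpre.zero.trans hS1.symm).le⟩, hpre.zero, hS1⟩
      mixed_omega_one := by
        rintro _ rfl
        exact ⟨_, rfl, homega⟩
      uniform_bound := by
        refine ⟨divFactorial (seqOfQuotients μ), fun j => div_pos (hpre.pos j) (by positivity),
          tendsto_root_divFactorial_zero h0 hpos hdiv, ?_⟩
        rintro _ rfl
        exact ⟨1, one_pos, fun j => (one_mul _).ge⟩
      logConcave := by
        rintro _ rfl
        exact logConcaveSeq_divFactorial h0 hpos hanti }

end Regularized

theorem mainTheorem10 (N : ℕ → ℝ) (hN : IsLC N)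
    (hβ : 1 < lowerMatuszewska (quotientSeq N))
    (hα : upperMatuszewska (quotientSeq N) < ⊤) :
    -- the dual sequence `D`
    (IsLC (dualSeq N) ∧ dualSeq N 0 = 1 ∧ dualSeq N 1 = 1) ∧
    0 < lowerMatuszewska (dualQuotients N) ∧
    OmegaOne (dualSeq N) ∧
    -- the construction of `L` from `D` is possible
    (∃ H : ℝ, IsAlmostDecreasingConst (dualQuotients N) H) ∧
    -- and for each admissible constant `H` the resulting `L` has the asserted properties
    ∀ H : ℝ, IsAlmostDecreasingConst (dualQuotients N) H →
      IsPreLC (regularizedSeq H (dualQuotients N)) ∧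
      regularizedSeq H (dualQuotients N) 1 ≤ 1 ∧
      Tendsto (rootSeq (divFactorial (regularizedSeq H (dualQuotients N)))) atTop (𝓝 0) ∧
      OmegaOne (regularizedSeq H (dualQuotients N)) ∧
      LogConcaveSeq (divFactorial (regularizedSeq H (dualQuotients N))) ∧
      -- the finite modification of `L`
      ∃ p₀ : ℕ,
        IsLeast {k : ℕ | 1 ≤ k ∧ ∀ p, k < p → 1 ≤ regularizedQuotients H (dualQuotients N) p} p₀ ∧
        IsAdmissibleFamily {modifiedSeq p₀ (regularizedQuotients H (dualQuotients N))} := by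
  have hN' : IsPreLC N := hN.toIsPreLC
  set δ := dualQuotients N with hδ_def
  have h0 : δ 0 = 1 := rfl
  have h1 : δ 1 = 1 := dualQuotients_one hN'
  have hge : ∀ p, 1 ≤ δ p := one_le_dualQuotients hN'
  have hpos : ∀ p, 0 < δ p := fun p => one_pos.trans_le (hge p)
  have hmono : Monotone δ := dualQuotients_mono hN'
  have htop : Tendsto δ atTop atTop := tendsto_dualQuotients hN'
  obtain ⟨c, hc, C, hC, hinc⟩ := exists_almostIncreasing_dualQuotients hN hα
  obtain ⟨e, he, C', hC', hdec⟩ := exists_almostDecreasing_dualQuotients hN hβ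
  have hQ := hinc.exists_mul_le hc (fun p => (hpos p).le) hC
  have hdiv := hdec.tendsto_div_self he (fun p => (hpos p).le)
  have hD : IsPreLC (dualSeq N) :=
    isPreLC_seqOfQuotients h0 hpos (fun p _ => hmono (Nat.le_succ p)) htop
  have hD1 : dualSeq N 1 = 1 := by
    rw [dualSeq, seqOfQuotients_succ, seqOfQuotients_zero, ← hδ_def, h0, h1, one_mul]
  refine ⟨⟨⟨hD, (hD.zero.trans hD1.symm).le⟩, hD.zero, hD1⟩, ?_, ?_, ?_, ?_⟩
  · refine lt_of_lt_of_le (EReal.coe_pos.2 hc) (le_sSup ⟨c, ⟨C, hC, hinc⟩, rfl⟩)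
  · exact omegaOne_of_comparable h0 hpos (fun p q _ hpq => hmono hpq) one_pos
      (fun p _ => le_rfl) (fun p _ => (one_mul _).ge) hQ
  · exact ⟨C', hC', hdec.div_self he (fun p => (hpos p).le) (zero_le_one.trans hC')⟩
  intro H h
  have hlpos := regularizedQuotients_pos h hpos
  have hlmono : ∀ p q, 1 ≤ p → p ≤ q →
      regularizedQuotients H δ p ≤ regularizedQuotients H δ q :=
    fun p q hp hpq => regularizedQuotients_mono h hmono hpos hp hpq
  refine ⟨?_, ?_, ?_, ?_, ?_, ?_⟩
  · exact isPreLC_seqOfQuotients rfl hlpos (fun p hp => hlmono _ _ hp (Nat.le_succ p))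
      (tendsto_regularizedQuotients h htop)
  · rw [regularizedSeq, seqOfQuotients_succ, seqOfQuotients_zero]
    exact (one_mul _).trans_le ((regularizedQuotients_le h le_rfl).trans_eq h1)
  · exact tendsto_root_divFactorial_zero rfl hlpos (tendsto_regularizedQuotients_div h hpos hdiv)
  · exact omegaOne_of_comparable rfl hlpos hlmono (one_pos.trans_le h.1)
      (fun p hp => regularizedQuotients_le h hp) (fun p hp => le_mul_regularizedQuotients h hp) hQ
  · exact logConcaveSeq_divFactorial rfl hlpos
      fun p hp => regularizedQuotients_div_le h hp (Nat.le_succ p)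
  · obtain ⟨p₀, hp₀⟩ := exists_isLeast_one_le_regularizedQuotients h htop
    exact ⟨p₀, hp₀, isAdmissibleFamily_modifiedSeq h hmono h1 hge htop hdiv hQ hp₀⟩
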